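/- Let $(\Omega,\rightarrow)$ be a finite semigroup with $\omega$ elements and let $\mathbb{K}$ be a field. Let $\mathbf{As}^2_\Omega$ be the nonsymmetric operad over $\mathbb{K}$ of two-parameters $\Omega$-associative algebras, that is, the operad generated by binary operations $*_{\alpha,\beta}$ ($\alpha,\beta\in\Omega$) subject to the relations $$*_{\alpha\rightarrow\beta,\gamma}\circ_1 *_{\alpha,\beta}=*_{\alpha,\beta\rightarrow\gamma}\circ_2 *_{\beta,\gamma}\qquad(\alpha,\beta,\gamma\in\Omega).$$ For every $n\geqslant 1$ the component $\mathbf{As}^2_\Omega(n)$ is finite-dimensional, and there is a polynomial $p_n\in\mathbb{Z}[X]$, depending only on $n$, such that $\dim_{\mathbb{K}}\mathbf{As}^2_\Omega(n)=p_n(\omega)$ for all such $\mathbb{K}$ and $\Omega$. It has the following properties. 1. $p_n$ has degree $2n-2$, and its leading coefficient is the Catalan number $\mathrm{cat}_n=\frac{1}{n}\binom{2n-2}{n-1}$ (so that $\mathrm{cat}_1=1$, $\mathrm{cat}_2=1$, $\mathrm{cat}_3=2$, $\mathrm{cat}_4=5$). 2. If $n\geqslant 2$, there is a polynomial $q_n\in\mathbb{Z}[X]$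 such that $p_n=X^nq_n$, and $q_n(0)=(-1)^n$. 3. If $n$ is odd and $n\geqslant 3$, then $p_n\left(\frac12\right)=0$. -/

import Mathlib

/-!
# The nonsymmetric operad of two-parameters `Ω`-associative algebras

The free nonsymmetric operad on binary generators `*_{α,β}`, `α, β ∈ Ω`, has as its arity `n`
component the vector space spanned by the planar binary trees with `n` leaves whose internal
vertices are decorated by `Ω × Ω`. The operad `As²_Ω` is its quotient by the operadic ideal
generated by the relations
`*_{α → β, γ} ∘₁ *_{α, β} = *_{α, β → γ} ∘₂ *_{β, γ}`.
The product of the semigroup `Ω` (written `→` on paper) is written `*`.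
-/

namespace TwoParamAs

/-- `graft t i s` replaces the leaf number `i` of `t` by the root of `s`
(leaves are numbered from left to right, starting from `0`). -/
def graft {A : Type*} : BinaryTree A → ℕ → BinaryTree A → BinaryTree A
  | .nil, i, s => if i = 0 then s else .nil
  | .node a l r, i, s =>
      if i < l.numLeaves then .node a (graft l i s) r
      else .node a l (graft r (i - l.numLeaves) s)

theorem numLeaves_graft_add_one {A : Type*} (t : BinaryTree A) (s : BinaryTree A) (i : ℕ)
    (hi : i < t.numLeaves) :
    (graft t i s).numLeaves + 1 = t.numLeaves + s.numLeaves := by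
  induction t generalizing i with
  | nil =>
    simp only [BinaryTree.numLeaves, Nat.lt_one_iff] at hi
    subst hi
    simp [graft, Nat.add_comm]
  | node a l r hl hr =>
    simp only [BinaryTree.numLeaves] at hi
    simp only [graft]
    split_ifs with h
    · have := hl i h
      simp only [BinaryTree.numLeaves]
      omega
    · have := hr (i - l.numLeaves) (by omega)
      simp only [BinaryTree.numLeaves]
      omega

/-- Planar binary trees with `n` leaves, the internal vertices being decorated by `Ω × Ω`. -/
abbrev DecTree (Ω : Type*) (n : ℕ) : Type _ :=
  {t : BinaryTree (Ω × Ω) // t.numLeaves = n}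

/-- Grafting a tree with `n` leaves on the leaf `i` of a tree with `m` leaves. -/
def DecTree.graft {Ω : Type*} {m n : ℕ} (i : Fin m) (t : DecTree Ω m) (s : DecTree Ω n) :
    DecTree Ω (m + n - 1) :=
  ⟨TwoParamAs.graft t.1 i s.1, by
    have h := numLeaves_graft_add_one t.1 s.1 i (by rw [t.2]; exact i.2)
    rw [t.2, s.2] at h
    omega⟩

/-- The arity `n` component of the free nonsymmetric operad over `K` generated by binary
operations indexed by `Ω × Ω`. -/
abbrev FreeOp (K : Type*) [Field K] (Ω : Type*) (n : ℕ) : Type _ :=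
  DecTree Ω n →₀ K

/-- The partial composition `x ∘ᵢ y` of the free operad: the bilinear extension of grafting
(inputs are numbered starting from `0`). -/
noncomputable def FreeOp.circ {K : Type*} [Field K] {Ω : Type*} {m n : ℕ} (i : Fin m) :
    FreeOp K Ω m →ₗ[K] FreeOp K Ω n →ₗ[K] FreeOp K Ω (m + n - 1) :=
  Finsupp.lift _ K _ fun t => Finsupp.lmapDomain K K (DecTree.graft i t)

/-- The generator `*_{α,β}` of arity `2`: the tree with one internal vertex. -/
noncomputable def gen (K : Type*) [Field K] {Ω : Type*} (α β : Ω) : FreeOp K Ω 2 :=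
  Finsupp.single ⟨.node (α, β) .nil .nil, rfl⟩ 1

/-- `*_{α → β, γ} ∘₁ *_{α, β} - *_{α, β → γ} ∘₂ *_{β, γ}`, an element of arity `3`. -/
noncomputable def relator (K : Type*) [Field K] {Ω : Type*} [Semigroup Ω] (α β γ : Ω) :
    FreeOp K Ω 3 :=
  (FreeOp.circ (0 : Fin 2) (gen K (α * β) γ) (gen K α β) : FreeOp K Ω (2 + 2 - 1)) -
    (FreeOp.circ (1 : Fin 2) (gen K α (β * γ)) (gen K β γ) : FreeOp K Ω (2 + 2 - 1))

/-- An operadic ideal of the free operad: a family of subspaces, one in each arity, stable under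
partial composition, on either side, with arbitrary elements. -/
structure IsOperadicIdeal {K : Type*} [Field K] {Ω : Type*}
    (I : ∀ n : ℕ, Submodule K (FreeOp K Ω n)) : Prop where
  circ_left_mem : ∀ {m n : ℕ} (i : Fin m) (x : FreeOp K Ω m) (y : FreeOp K Ω n),
    x ∈ I m → FreeOp.circ i x y ∈ I (m + n - 1)
  circ_right_mem : ∀ {m n : ℕ} (i : Fin m) (x : FreeOp K Ω m) (y : FreeOp K Ω n),
    y ∈ I n → FreeOp.circ i x y ∈ I (m + n - 1)

/-- The arity `n` component of the operadic ideal generated by the relators, i.e. of the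
intersection of all the operadic ideals that contain them. -/
noncomputable def relIdeal (K : Type*) [Field K] (Ω : Type*) [Semigroup Ω] (n : ℕ) :
    Submodule K (FreeOp K Ω n) :=
  sInf {J | ∃ I : ∀ k : ℕ, Submodule K (FreeOp K Ω k), IsOperadicIdeal I ∧
    (∀ α β γ : Ω, relator K α β γ ∈ I 3) ∧ J = I n}

theorem isOperadicIdeal_relIdeal (K : Type*) [Field K] (Ω : Type*) [Semigroup Ω] :
    IsOperadicIdeal (relIdeal K Ω) where
  circ_left_mem := by
    intro m n i x y hx
    simp only [relIdeal, Submodule.mem_sInf] at hx ⊢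
    rintro _ ⟨I, hI, hr, rfl⟩
    exact hI.circ_left_mem i x y (hx _ ⟨I, hI, hr, rfl⟩)
  circ_right_mem := by
    intro m n i x y hy
    simp only [relIdeal, Submodule.mem_sInf] at hy ⊢
    rintro _ ⟨I, hI, hr, rfl⟩
    exact hI.circ_right_mem i x y (hy _ ⟨I, hI, hr, rfl⟩)

theorem relator_mem_relIdeal (K : Type*) [Field K] {Ω : Type*} [Semigroup Ω] (α β γ : Ω) :
    relator K α β γ ∈ relIdeal K Ω 3 := by
  simp only [relIdeal, Submodule.mem_sInf]
  rintro _ ⟨I, _, hr, rfl⟩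
  exact hr α β γ

/-- The arity `n` component `As²_Ω(n)` of the nonsymmetric operad of two-parameters
`Ω`-associative algebras over the field `K`. -/
abbrev As2 (K : Type*) [Field K] (Ω : Type*) [Semigroup Ω] (n : ℕ) : Type _ :=
  FreeOp K Ω n ⧸ relIdeal K Ω n

end TwoParamAs

/-!
# The dimensions of the operad of two-parameters `Ω`-associative algebras

Orient the defining relation from left to right: a vertex decorated by `(α → β, γ)` whose left child
is decorated by `(α, β)` is rewritten. The rewriting terminates and is confluent, because the
associativity of `Ω` makes the two ways round the only critical pair agree. Hence the trees to which
it does not apply, the normal trees, form a basis of `As²_Ω(n)` (`as2Equiv`). Concretely, the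
reduced product `treeMul` is a binary operation on trees that satisfies the relations exactly
(`treeMul_assoc`); evaluating a tree with it gives its `normalForm`, and the ideal of relations is
the kernel of the linear extension of `normalForm` (`relIdeal_eq_ker`).

In a normal tree, a vertex whose left child is a leaf has `ω²` decorations. If the left child is
internal, the first entry has to avoid one value, which leaves `ω (ω - 1)` decorations. So the
planar binary tree `s` with `n - 1 ≥ 1` internal vertices, of which `l` are left children and `r`
are right children, contributes `ω ^ n * (ω ^ r * (ω - 1) ^ l)`, where `l + r = n - 2`
(`card_normalTrees`, `countPoly_eq`). Summed over the `catalan (n - 1)` planar trees this is the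
polynomial of the theorem. Each summand is monic of degree `2 n - 2`; after division by `X ^ n` only
the left comb survives at `0`; and reflection of trees exchanges `l` and `r`, so that at `1/2`, where
`X` and `X - 1` are opposite to each other, the sum vanishes if `l + r` is odd.
-/

namespace TwoParamAs

/-! ### Normal forms -/

theorem graft_node_left {A : Type*} (a : A) (l r s : BinaryTree A) {i : ℕ} (h : i < l.numLeaves) :
    graft (.node a l r) i s = .node a (graft l i s) r := if_pos h

theorem graft_node_right {A : Type*} (a : A) (l r s : BinaryTree A) (i : ℕ) :
    graft (.node a l r) (l.numLeaves + i) s = .node a l (graft r i s) := by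
  simp [graft]

section NormalForms

variable {Ω : Type*} [Semigroup Ω]

/-- The reduced product `*_{a.1,a.2}` of trees: `L` and `R` are joined by a root decorated by `a`,
and as long as the first entry of this decoration is the product of the decorations of the left
child, the relation is used to push the vertex to the right. On normal trees this is the product of
the free two-parameters `Ω`-associative algebra with the generator `nil`. -/
noncomputable def treeMul : Ω × Ω → BinaryTree (Ω × Ω) → BinaryTree (Ω × Ω) → BinaryTree (Ω × Ω)
  | a, .nil, R => .node a .nil R
  | a, .node b x y, R =>
      open Classical in
      if b.1 * b.2 = a.1 then .node (b.1, b.2 * a.2) x (treeMul (b.2, a.2) y R)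
      else .node a (.node b x y) R

/-- The value of a tree of operations in the reduced products, all inputs being `nil`. -/
noncomputable def normalForm : BinaryTree (Ω × Ω) → BinaryTree (Ω × Ω)
  | .nil => .nil
  | .node a l r => treeMul a (normalForm l) (normalForm r)

/-- The root decoration `a` and the left subtree do not form the left-hand side
`*_{α → β, γ} ∘₁ *_{α, β}` of a relation. -/
def RootReduced (a : Ω × Ω) : BinaryTree (Ω × Ω) → Prop
  | .nil => True
  | .node b _ _ => b.1 * b.2 ≠ a.1

/-- A tree is normal if it contains no left-hand side of a relation. -/
def IsNormal : BinaryTree (Ω × Ω) → Prop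
  | .nil => True
  | .node a l r => RootReduced a l ∧ IsNormal l ∧ IsNormal r

/-- The product of trees satisfies the defining relations; this is the confluence of the
rewriting of left-hand sides into right-hand sides. -/
theorem treeMul_assoc (α β γ : Ω) (x y z : BinaryTree (Ω × Ω)) :
    treeMul (α * β, γ) (treeMul (α, β) x y) z =
      treeMul (α, β * γ) x (treeMul (β, γ) y z) := by
  induction x generalizing α β γ y z with
  | nil => simp [treeMul]
  | node b u v _ ihv =>
    by_cases h : b.1 * b.2 = α
    · subst h
      simp [treeMul, mul_assoc, ihv]
    · simp [treeMul, h]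

theorem isNormal_treeMul {a : Ω × Ω} {L R : BinaryTree (Ω × Ω)} (hL : IsNormal L)
    (hR : IsNormal R) : IsNormal (treeMul a L R) := by
  induction L generalizing a with
  | nil => exact ⟨trivial, trivial, hR⟩
  | node b x y _ ihy =>
    simp only [treeMul]
    split_ifs with h
    · exact ⟨by cases x <;> exact hL.1, hL.2.1, ihy hL.2.2⟩
    · exact ⟨h, hL, hR⟩

theorem isNormal_normalForm (t : BinaryTree (Ω × Ω)) : IsNormal (normalForm t) := by
  induction t with
  | nil => trivial
  | node a l r hl hr => exact isNormal_treeMul hl hr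

theorem treeMul_of_rootReduced {a : Ω × Ω} {L : BinaryTree (Ω × Ω)} (h : RootReduced a L)
    (R : BinaryTree (Ω × Ω)) : treeMul a L R = .node a L R := by
  cases L with
  | nil => rfl
  | node b x y => exact if_neg h

theorem normalForm_of_isNormal {t : BinaryTree (Ω × Ω)} (h : IsNormal t) : normalForm t = t := by
  induction t with
  | nil => rfl
  | node a l r hl hr =>
    rw [normalForm, hl h.2.1, hr h.2.2, treeMul_of_rootReduced h.1]

theorem normalForm_normalForm (t : BinaryTree (Ω × Ω)) :
    normalForm (normalForm t) = normalForm t :=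
  normalForm_of_isNormal (isNormal_normalForm t)

theorem numLeaves_treeMul (a : Ω × Ω) (L R : BinaryTree (Ω × Ω)) :
    (treeMul a L R).numLeaves = L.numLeaves + R.numLeaves := by
  induction L generalizing a with
  | nil => rfl
  | node b x y _ ihy =>
    simp only [treeMul]
    split_ifs
    · simp [ihy, add_assoc]
    · rfl

theorem numLeaves_normalForm (t : BinaryTree (Ω × Ω)) :
    (normalForm t).numLeaves = t.numLeaves := by
  induction t with
  | nil => rfl
  | node a l r hl hr => simp [normalForm, numLeaves_treeMul, hl, hr]

theorem normalForm_treeMul (a : Ω × Ω) (L R : BinaryTree (Ω × Ω)) :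
    normalForm (treeMul a L R) = treeMul a (normalForm L) (normalForm R) := by
  induction L generalizing a with
  | nil => rfl
  | node b x y _ ihy =>
    rw [treeMul]
    split_ifs with h
    · obtain ⟨c, d⟩ := a
      obtain ⟨e, f⟩ := b
      obtain rfl : e * f = c := h
      simp only [normalForm, ihy, treeMul_assoc]
    · rfl

/-- Normal forms before and after reducing the root are the same, even if a tree is grafted on a
leaf: this makes equality of normal forms a congruence for grafting. -/
theorem normalForm_graft_treeMul (a : Ω × Ω) (L R s : BinaryTree (Ω × Ω)) (i : ℕ) :
    normalForm (graft (treeMul a L R) i s) = normalForm (graft (.node a L R) i s) := by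
  induction L generalizing a i with
  | nil => rfl
  | node b x y _ ihy =>
    rw [treeMul]
    split_ifs with h
    · obtain ⟨c, d⟩ := a
      obtain ⟨e, f⟩ := b
      obtain rfl : e * f = c := h
      obtain h1 | ⟨j, rfl⟩ := (lt_or_ge i x.numLeaves).imp_right Nat.exists_eq_add_of_le
      · have h2 : i < (BinaryTree.node (e, f) x y).numLeaves := Nat.lt_add_right _ h1
        simp only [graft_node_left _ _ _ _ h1, graft_node_left _ _ _ _ h2, normalForm,
          normalForm_treeMul, treeMul_assoc]
      · rw [graft_node_right, normalForm, ihy]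
        obtain h2 | ⟨k, rfl⟩ := (lt_or_ge j y.numLeaves).imp_right Nat.exists_eq_add_of_le
        · have h3 : x.numLeaves + j < (BinaryTree.node (e, f) x y).numLeaves :=
            Nat.add_lt_add_left h2 _
          simp only [graft_node_left _ _ _ _ h2, graft_node_left _ _ _ _ h3, graft_node_right,
            normalForm, treeMul_assoc]
        · have h3 : x.numLeaves + (y.numLeaves + k) =
              (BinaryTree.node (e, f) x y).numLeaves + k := (Nat.add_assoc _ _ _).symm
          rw [h3]
          simp only [graft_node_right, normalForm, treeMul_assoc]
    · rfl

theorem normalForm_graft_normalForm_left (t s : BinaryTree (Ω × Ω)) (i : ℕ) :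
    normalForm (graft (normalForm t) i s) = normalForm (graft t i s) := by
  induction t generalizing i with
  | nil => rfl
  | node a l r hl hr =>
    rw [normalForm, normalForm_graft_treeMul]
    obtain h | ⟨j, rfl⟩ := (lt_or_ge i l.numLeaves).imp_right Nat.exists_eq_add_of_le
    · rw [graft_node_left _ _ _ _ h, graft_node_left _ _ _ _ ((numLeaves_normalForm l).symm ▸ h)]
      simp only [normalForm, hl, normalForm_normalForm]
    · rw [graft_node_right]
      nth_rw 1 [← numLeaves_normalForm l]
      rw [graft_node_right]
      simp only [normalForm, hr, normalForm_normalForm]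

theorem normalForm_graft_normalForm_right (t s : BinaryTree (Ω × Ω)) (i : ℕ) :
    normalForm (graft t i (normalForm s)) = normalForm (graft t i s) := by
  induction t generalizing i with
  | nil => simp only [graft]; split_ifs <;> simp [normalForm_normalForm]
  | node a l r hl hr => simp only [graft]; split_ifs <;> simp only [normalForm, hl, hr]

end NormalForms

/-! ### The ideal of relations -/

section Ideal

variable (K : Type*) [Field K] {Ω : Type*}

theorem circ_single {m n : ℕ} (i : Fin m) (t : DecTree Ω m) (s : DecTree Ω n) :
    FreeOp.circ i (Finsupp.single t (1 : K)) (Finsupp.single s 1) =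
      Finsupp.single (t.graft i s) 1 := by
  simp [FreeOp.circ]

variable [Semigroup Ω]

/-- The normal form, as a map of the trees with `n` leaves. -/
noncomputable def DecTree.normalForm {n : ℕ} (t : DecTree Ω n) : DecTree Ω n :=
  ⟨TwoParamAs.normalForm t.1, (numLeaves_normalForm t.1).trans t.2⟩

/-- The linear extension of the normal form to the free operad. -/
noncomputable def normalFormLin (n : ℕ) : FreeOp K Ω n →ₗ[K] FreeOp K Ω n :=
  Finsupp.lmapDomain K K DecTree.normalForm

theorem normalFormLin_single {n : ℕ} (t : DecTree Ω n) :
    normalFormLin K n (Finsupp.single t 1) = Finsupp.single t.normalForm 1 := by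
  simp [normalFormLin]

theorem normalFormLin_circ_left {m n : ℕ} (i : Fin m) (x : FreeOp K Ω m) (y : FreeOp K Ω n) :
    normalFormLin K _ (FreeOp.circ i (normalFormLin K m x) y) =
      normalFormLin K _ (FreeOp.circ i x y) := by
  have : (FreeOp.circ i ∘ₗ normalFormLin K m).compr₂ (normalFormLin K (m + n - 1)) =
      (FreeOp.circ i).compr₂ (normalFormLin K (Ω := Ω) (m + n - 1)) := by
    ext t s : 4
    simp only [LinearMap.comp_apply, Finsupp.lsingle_apply, LinearMap.compr₂_apply,
      normalFormLin_single, circ_single]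
    congr 1
    exact Subtype.ext (normalForm_graft_normalForm_left _ _ _)
  exact DFunLike.congr_fun (DFunLike.congr_fun this x) y

theorem normalFormLin_circ_right {m n : ℕ} (i : Fin m) (x : FreeOp K Ω m) (y : FreeOp K Ω n) :
    normalFormLin K _ (FreeOp.circ i x (normalFormLin K n y)) =
      normalFormLin K _ (FreeOp.circ i x y) := by
  have : ((FreeOp.circ i).compl₂ (normalFormLin K n)).compr₂ (normalFormLin K (m + n - 1)) =
      (FreeOp.circ i).compr₂ (normalFormLin K (Ω := Ω) (m + n - 1)) := by
    ext t s : 4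
    simp only [LinearMap.comp_apply, Finsupp.lsingle_apply, LinearMap.compr₂_apply,
      LinearMap.compl₂_apply, normalFormLin_single, circ_single]
    congr 1
    exact Subtype.ext (normalForm_graft_normalForm_right _ _ _)
  exact DFunLike.congr_fun (DFunLike.congr_fun this x) y

theorem isOperadicIdeal_ker_normalFormLin :
    IsOperadicIdeal fun n => LinearMap.ker (normalFormLin K (Ω := Ω) n) where
  circ_left_mem i x y hx := by
    rw [LinearMap.mem_ker] at hx ⊢
    rw [← normalFormLin_circ_left, hx]
    simp
  circ_right_mem i x y hy := by
    rw [LinearMap.mem_ker] at hy ⊢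
    rw [← normalFormLin_circ_right, hy]
    simp

theorem relator_eq (α β γ : Ω) :
    relator K α β γ =
      Finsupp.single ⟨.node (α * β, γ) (.node (α, β) .nil .nil) .nil, rfl⟩ 1 -
        Finsupp.single ⟨.node (α, β * γ) .nil (.node (β, γ) .nil .nil), rfl⟩ 1 := by
  simp only [relator, gen, circ_single]
  rfl

theorem relator_mem_ker (α β γ : Ω) :
    relator K α β γ ∈ LinearMap.ker (normalFormLin K (Ω := Ω) 3) := by
  rw [LinearMap.mem_ker, relator_eq, map_sub, normalFormLin_single, normalFormLin_single,
    sub_eq_zero]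
  congr 1
  exact Subtype.ext (treeMul_assoc α β γ .nil .nil .nil)

/-- Two decorated trees are identified in the operad `As²_Ω`. -/
def TreeRel (t t' : BinaryTree (Ω × Ω)) : Prop :=
  ∃ (n : ℕ) (h : t.numLeaves = n) (h' : t'.numLeaves = n),
    (Finsupp.single ⟨t, h⟩ 1 - Finsupp.single ⟨t', h'⟩ 1 : FreeOp K Ω n) ∈ relIdeal K Ω n

variable {K}

theorem TreeRel.refl (t : BinaryTree (Ω × Ω)) : TreeRel K t t :=
  ⟨_, rfl, rfl, by rw [sub_self]; exact zero_mem _⟩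

theorem TreeRel.trans {t t' t'' : BinaryTree (Ω × Ω)} (h : TreeRel K t t')
    (h' : TreeRel K t' t'') : TreeRel K t t'' := by
  obtain ⟨n, h1, h2, h3⟩ := h
  obtain ⟨m, h4, h5, h6⟩ := h'
  obtain rfl : n = m := h2.symm.trans h4
  exact ⟨n, h1, h5, by simpa using add_mem h3 h6⟩

theorem TreeRel.graft_left {t t' : BinaryTree (Ω × Ω)} (h : TreeRel K t t') {i : ℕ}
    (hi : i < t.numLeaves) (s : BinaryTree (Ω × Ω)) :
    TreeRel K (graft t i s) (graft t' i s) := by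
  obtain ⟨n, h1, h2, h3⟩ := h
  have := (isOperadicIdeal_relIdeal K Ω).circ_left_mem ⟨i, h1 ▸ hi⟩ _
    (Finsupp.single (⟨s, rfl⟩ : DecTree Ω _) 1) h3
  rw [map_sub, LinearMap.sub_apply, circ_single, circ_single] at this
  exact ⟨_, _, _, this⟩

theorem TreeRel.graft_right {s s' : BinaryTree (Ω × Ω)} (h : TreeRel K s s')
    (t : BinaryTree (Ω × Ω)) {i : ℕ} (hi : i < t.numLeaves) :
    TreeRel K (graft t i s) (graft t i s') := by
  obtain ⟨n, h1, h2, h3⟩ := h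
  have := (isOperadicIdeal_relIdeal K Ω).circ_right_mem (⟨i, hi⟩ : Fin t.numLeaves)
    (Finsupp.single (⟨t, rfl⟩ : DecTree Ω _) 1) _ h3
  rw [map_sub, circ_single, circ_single] at this
  exact ⟨_, _, _, this⟩

theorem TreeRel.node {l l' r r' : BinaryTree (Ω × Ω)} (a : Ω × Ω) (hl : TreeRel K l l')
    (hr : TreeRel K r r') : TreeRel K (.node a l r) (.node a l' r') := by
  have h1 : TreeRel K (.node a l r) (.node a l' r) := by
    simpa [graft] using hl.graft_right (.node a .nil r) (i := 0) (by simp)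
  have h2 : TreeRel K (.node a l' r) (.node a l' r') := by
    simpa [graft] using hr.graft_right (.node a l' .nil) (i := l'.numLeaves) (by simp)
  exact h1.trans h2

/-- The defining relation, with arbitrary trees grafted on its three leaves. -/
theorem treeRel_assoc (α β γ : Ω) (x y z : BinaryTree (Ω × Ω)) :
    TreeRel K (.node (α * β, γ) (.node (α, β) x y) z) (.node (α, β * γ) x (.node (β, γ) y z)) := by
  have h : TreeRel K (.node (α * β, γ) (.node (α, β) .nil .nil) .nil)
      (.node (α, β * γ) .nil (.node (β, γ) .nil .nil)) :=
    ⟨3, rfl, rfl, relator_eq K α β γ ▸ relator_mem_relIdeal K α β γ⟩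
  -- Grafting from right to left keeps the numbers of the remaining leaves.
  have hz := h.graft_left (i := 2) (by simp) z
  have hy := hz.graft_left (i := 1) (by simp [graft]; omega) y
  simpa [graft] using hy.graft_left (i := 0) (by simp [graft]) x

theorem treeRel_treeMul (a : Ω × Ω) (L R : BinaryTree (Ω × Ω)) :
    TreeRel K (.node a L R) (treeMul a L R) := by
  induction L generalizing a with
  | nil => exact .refl _
  | node b x y _ ihy =>
    rw [treeMul]
    split_ifs with h
    · obtain ⟨c, d⟩ := a
      obtain ⟨e, f⟩ := b
      obtain rfl : e * f = c := h
      exact (treeRel_assoc e f d x y R).trans (.node _ (.refl _) (ihy _))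
    · exact .refl _

theorem treeRel_normalForm (t : BinaryTree (Ω × Ω)) : TreeRel K t (normalForm t) := by
  induction t with
  | nil => exact .refl _
  | node a l r hl hr => exact (hl.node a hr).trans (treeRel_treeMul a _ _)

theorem sub_normalFormLin_mem {n : ℕ} (x : FreeOp K Ω n) :
    x - normalFormLin K n x ∈ relIdeal K Ω n := by
  induction x using Finsupp.induction_linear with
  | zero => simp
  | add x y hx hy => rw [map_add, add_sub_add_comm]; exact add_mem hx hy
  | single t c =>
    obtain ⟨m, h1, h2, h3⟩ := treeRel_normalForm (K := K) t.1
    obtain rfl : n = m := t.2.symm.trans h1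
    have := (relIdeal K Ω n).smul_mem c h3
    rw [← mul_one c, ← smul_eq_mul, ← Finsupp.smul_single, map_smul, normalFormLin_single,
      ← smul_sub]
    exact this

variable (K Ω) in
/-- An element of the free operad vanishes in `As²_Ω` exactly if its normal form vanishes. -/
theorem relIdeal_eq_ker (n : ℕ) : relIdeal K Ω n = LinearMap.ker (normalFormLin K n) := by
  apply le_antisymm
  · exact sInf_le ⟨_, isOperadicIdeal_ker_normalFormLin K, relator_mem_ker K, rfl⟩
  · intro x hx
    simpa [LinearMap.mem_ker.1 hx] using sub_normalFormLin_mem x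

variable (K Ω) in
/-- The normal trees with `n` leaves are a basis of `As²_Ω(n)`. -/
noncomputable def as2Equiv (n : ℕ) :
    As2 K Ω n ≃ₗ[K] ({t : DecTree Ω n // IsNormal t.1} →₀ K) :=
  have hker : relIdeal K Ω n = LinearMap.ker (Finsupp.lmapDomain K K
      fun t : DecTree Ω n => (⟨t.normalForm, isNormal_normalForm t.1⟩ :
        {t : DecTree Ω n // IsNormal t.1})) := by
    rw [relIdeal_eq_ker]
    have : normalFormLin K (Ω := Ω) n = Finsupp.lmapDomain K K Subtype.val ∘ₗ
        Finsupp.lmapDomain K K fun t : DecTree Ω n =>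
          (⟨t.normalForm, isNormal_normalForm t.1⟩ : {t : DecTree Ω n // IsNormal t.1}) := by
      rw [← Finsupp.lmapDomain_comp]; rfl
    rw [this, LinearMap.ker_comp_of_ker_eq_bot]
    exact LinearMap.ker_eq_bot.2 (Finsupp.mapDomain_injective Subtype.val_injective)
  (Submodule.quotEquivOfEq _ _ hker).trans <|
    LinearMap.quotKerEquivOfSurjective _ <| Finsupp.mapDomain_surjective fun t =>
      ⟨t.1, Subtype.ext (Subtype.ext (normalForm_of_isNormal t.2))⟩

end Ideal

/-! ### Counting normal trees of a given shape -/

section Counting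

open Polynomial

/-- The polynomial counting the decorations of a given shape which are normal: the decoration of a
vertex is an arbitrary pair if its left child is a leaf, and otherwise its first entry avoids one
value, which is determined by the decoration of the left child. -/
noncomputable def countPoly : BinaryTree Unit → ℤ[X]
  | .nil => 1
  | .node _ l r => X * (if l = .nil then X else X - 1) * countPoly l * countPoly r

variable {Ω : Type*} [Semigroup Ω] [Fintype Ω]

open Classical in
theorem card_rootReduced (t : BinaryTree (Ω × Ω)) :
    ((Finset.univ.filter fun a : Ω × Ω => RootReduced a t).card : ℤ) =
      Fintype.card Ω * (if t = .nil then (Fintype.card Ω : ℤ) else Fintype.card Ω - 1) := by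
  cases t with
  | nil =>
    rw [Finset.filter_true_of_mem (p := fun a : Ω × Ω => RootReduced a .nil) fun _ _ => trivial]
    simp
  | node b x y =>
    have : (Finset.univ.filter fun a : Ω × Ω => RootReduced a (.node b x y)) =
        ({b.1 * b.2}ᶜ : Finset Ω) ×ˢ Finset.univ := by
      ext a
      simp [RootReduced, eq_comm]
    have hpos : 1 ≤ Fintype.card Ω := Fintype.card_pos_iff.2 ⟨b.1⟩
    rw [this, Finset.card_product, Finset.card_compl, Finset.card_singleton, Finset.card_univ]
    simp [Nat.cast_sub hpos, mul_comm]

open Classical in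
/-- The normal trees decorated by `Ω × Ω` whose underlying planar binary tree is given. -/
noncomputable def normalTrees : BinaryTree Unit → Finset (BinaryTree (Ω × Ω))
  | .nil => {.nil}
  | .node _ l r =>
      ((normalTrees l ×ˢ normalTrees r).sigma fun p =>
        Finset.univ.filter fun a => RootReduced a p.1).map
      ⟨fun x => .node x.2 x.1.1 x.1.2, by
        rintro ⟨⟨x, y⟩, a⟩ ⟨⟨x', y'⟩, a'⟩ h
        simp only [BinaryTree.node.injEq] at h
        obtain ⟨rfl, rfl, rfl⟩ := h
        rfl⟩

theorem mem_normalTrees {s : BinaryTree Unit} {t : BinaryTree (Ω × Ω)} :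
    t ∈ normalTrees s ↔ IsNormal t ∧ t.map (fun _ => ()) = s := by
  induction s generalizing t with
  | nil => cases t <;> simp [normalTrees, IsNormal, BinaryTree.map]
  | node u l r hl hr =>
    cases t with
    | nil => simp [normalTrees, BinaryTree.map]
    | node a x y =>
      simp only [normalTrees, Finset.mem_map, Finset.mem_sigma, Finset.mem_product,
        Finset.mem_filter, Finset.mem_univ, true_and, hl, hr,
        IsNormal, BinaryTree.map, BinaryTree.node.injEq]
      constructor
      · rintro ⟨⟨⟨x', y'⟩, a'⟩, h, h'⟩
        obtain ⟨rfl, rfl, rfl⟩ := BinaryTree.node.inj h'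
        exact ⟨⟨h.2, h.1.1.1, h.1.2.1⟩, h.1.1.2, h.1.2.2⟩
      · rintro ⟨⟨h1, h2, h3⟩, h4, h5⟩
        exact ⟨⟨⟨x, y⟩, a⟩, ⟨⟨⟨h2, h4⟩, h3, h5⟩, h1⟩, rfl⟩

theorem map_eq_nil_iff {A B : Type*} (f : A → B) (t : BinaryTree A) :
    t.map f = .nil ↔ t = .nil := by
  cases t <;> simp [BinaryTree.map]

theorem numNodes_map {A B : Type*} (f : A → B) (t : BinaryTree A) :
    (t.map f).numNodes = t.numNodes := by
  induction t <;> simp [BinaryTree.map, *]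

theorem card_normalTrees (s : BinaryTree Unit) :
    ((normalTrees (Ω := Ω) s).card : ℤ) = (countPoly s).eval (Fintype.card Ω : ℤ) := by
  induction s with
  | nil => simp [normalTrees, countPoly]
  | node u l r hl hr =>
    rw [normalTrees, Finset.card_map, Finset.card_sigma, Nat.cast_sum, Finset.sum_congr rfl
      (g := fun _ => (Fintype.card Ω : ℤ) *
        (if l = .nil then (Fintype.card Ω : ℤ) else Fintype.card Ω - 1))]
    · rw [Finset.sum_const, Finset.card_product, nsmul_eq_mul, Nat.cast_mul, hl, hr, countPoly]
      split_ifs <;> simp <;> ring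
    · intro p hp
      have h := (mem_normalTrees.1 (Finset.mem_product.1 hp).1).2
      have h' : p.1 = .nil ↔ l = .nil := by rw [← h, map_eq_nil_iff]
      rw [card_rootReduced]
      simp only [h']

open Classical in
/-- Normal trees with `m + 1` leaves are sorted by the underlying planar binary tree. -/
noncomputable def normalTreesEquiv (m : ℕ) :
    {t : DecTree Ω (m + 1) // IsNormal t.1} ≃
      ↥((BinaryTree.treesOfNumNodesEq m).biUnion (normalTrees (Ω := Ω))) :=
  (Equiv.subtypeSubtypeEquivSubtypeInter _ _).trans <| Equiv.subtypeEquivRight fun t => by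
    simp [mem_normalTrees, BinaryTree.numLeaves_eq_numNodes_succ, numNodes_map]

theorem card_isNormal (m : ℕ) :
    (Nat.card {t : DecTree Ω (m + 1) // IsNormal t.1} : ℤ) =
      (∑ s ∈ BinaryTree.treesOfNumNodesEq m, countPoly s).eval (Nat.card Ω : ℤ) := by
  classical
  rw [Nat.card_congr (normalTreesEquiv m), Nat.card_eq_fintype_card, Fintype.card_coe,
    Finset.card_biUnion, Nat.cast_sum, eval_finsetSum, Nat.card_eq_fintype_card]
  · exact Finset.sum_congr rfl fun s _ => card_normalTrees s
  · intro s _ s' _ hne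
    refine Finset.disjoint_left.2 ?_
    intro t ht ht'
    exact hne ((mem_normalTrees.1 ht).2.symm.trans (mem_normalTrees.1 ht').2)

end Counting

/-! ### The counting polynomial -/

section CountingPolynomial

open Polynomial

theorem monic_countPoly (s : BinaryTree Unit) : (countPoly s).Monic := by
  induction s with
  | nil => exact monic_one
  | node u l r hl hr =>
    refine ((monic_X.mul ?_).mul hl).mul hr
    split_ifs
    exacts [monic_X, monic_X_sub_C 1]

theorem natDegree_countPoly (s : BinaryTree Unit) :
    (countPoly s).natDegree = 2 * s.numNodes := by
  induction s with
  | nil => simp [countPoly]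
  | node u l r hl hr =>
    have h1 : (if l = .nil then X else X - 1 : ℤ[X]).Monic := by
      split_ifs
      exacts [monic_X, monic_X_sub_C 1]
    have h2 : (if l = .nil then X else X - 1 : ℤ[X]).natDegree = 1 := by
      split_ifs
      exacts [natDegree_X, natDegree_X_sub_C 1]
    rw [countPoly, ((monic_X.mul h1).mul (monic_countPoly l)).natDegree_mul (monic_countPoly r),
      (monic_X.mul h1).natDegree_mul (monic_countPoly l), monic_X.natDegree_mul h1, h2, hl, hr,
      natDegree_X, BinaryTree.numNodes]
    ring

/-- The number of internal vertices which are left children. -/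
def leftEdges : BinaryTree Unit → ℕ
  | .nil => 0
  | .node _ l r => (if l = .nil then 0 else 1) + leftEdges l + leftEdges r

/-- The number of internal vertices which are right children. -/
def rightEdges : BinaryTree Unit → ℕ
  | .nil => 0
  | .node _ l r => (if r = .nil then 0 else 1) + rightEdges l + rightEdges r

/-- The tree reflected in a vertical line. -/
def mirror : BinaryTree Unit → BinaryTree Unit
  | .nil => .nil
  | .node a l r => .node a (mirror r) (mirror l)

/-- The tree with `n` internal vertices none of which is a right child. -/
def leftComb : ℕ → BinaryTree Unit
  | 0 => .nil
  | n + 1 => .node () (leftComb n) .nil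

theorem mirror_mirror (s : BinaryTree Unit) : mirror (mirror s) = s := by
  induction s <;> simp [mirror, *]

theorem mirror_eq_nil_iff (s : BinaryTree Unit) : mirror s = .nil ↔ s = .nil := by
  cases s <;> simp [mirror]

theorem numNodes_mirror (s : BinaryTree Unit) : (mirror s).numNodes = s.numNodes := by
  induction s with
  | nil => rfl
  | node a l r hl hr => simp [mirror, hl, hr, add_comm]

theorem leftEdges_mirror (s : BinaryTree Unit) : leftEdges (mirror s) = rightEdges s := by
  induction s with
  | nil => rfl
  | node a l r hl hr =>
    simp only [mirror, leftEdges, rightEdges, mirror_eq_nil_iff, hl, hr]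
    ring

theorem rightEdges_mirror (s : BinaryTree Unit) : rightEdges (mirror s) = leftEdges s := by
  rw [← leftEdges_mirror, mirror_mirror]

theorem numNodes_leftComb (n : ℕ) : (leftComb n).numNodes = n := by
  induction n <;> simp [leftComb, *]

theorem rightEdges_leftComb (n : ℕ) : rightEdges (leftComb n) = 0 := by
  induction n <;> simp [leftComb, rightEdges, *]

theorem eq_leftComb_of_rightEdges_eq_zero {s : BinaryTree Unit} (h : rightEdges s = 0) :
    s = leftComb s.numNodes := by
  induction s with
  | nil => rfl
  | node u l r hl _ =>
    simp only [rightEdges, Nat.add_eq_zero_iff, ite_eq_left_iff, one_ne_zero, imp_false,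
      not_not] at h
    obtain ⟨⟨rfl, h⟩, -⟩ := h
    rw [BinaryTree.numNodes, BinaryTree.numNodes, add_zero, leftComb, ← hl h]

theorem leftEdges_add_rightEdges {s : BinaryTree Unit} (hs : s ≠ .nil) :
    leftEdges s + rightEdges s + 1 = s.numNodes := by
  induction s with
  | nil => exact absurd rfl hs
  | node u l r hl hr =>
    by_cases h1 : l = .nil <;> by_cases h2 : r = .nil <;>
      simp_all [leftEdges, rightEdges] <;> omega

theorem countPoly_eq {s : BinaryTree Unit} (hs : s ≠ .nil) :
    countPoly s = X ^ (s.numNodes + 1) * (X ^ rightEdges s * (X - 1) ^ leftEdges s) := by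
  induction s with
  | nil => exact absurd rfl hs
  | node u l r hl hr =>
    rw [countPoly]
    by_cases h1 : l = .nil <;> by_cases h2 : r = .nil
    · subst h1 h2
      simp [countPoly, leftEdges, rightEdges]
      ring
    · subst h1
      simp [countPoly, leftEdges, rightEdges, h2, hr h2]
      ring
    · subst h2
      simp [countPoly, leftEdges, rightEdges, h1, hl h1]
      ring
    · simp [leftEdges, rightEdges, h1, h2, hl h1, hr h2]
      ring

theorem ne_nil_of_mem {m : ℕ} {s : BinaryTree Unit}
    (hs : s ∈ BinaryTree.treesOfNumNodesEq (m + 1)) : s ≠ .nil := by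
  rintro rfl
  simp at hs

theorem natDegree_sum_countPoly_le (m : ℕ) :
    (∑ s ∈ BinaryTree.treesOfNumNodesEq m, countPoly s).natDegree ≤ 2 * m :=
  natDegree_sum_le_of_forall_le _ _ fun s hs => by
    rw [natDegree_countPoly, BinaryTree.mem_treesOfNumNodesEq.1 hs]

theorem coeff_sum_countPoly (m : ℕ) :
    (∑ s ∈ BinaryTree.treesOfNumNodesEq m, countPoly s).coeff (2 * m) = catalan m := by
  rw [finsetSum_coeff, Finset.sum_congr rfl (g := fun _ => 1),
    ← BinaryTree.treesOfNumNodesEq_card_eq_catalan]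
  · simp
  · intro s hs
    rw [← BinaryTree.mem_treesOfNumNodesEq.1 hs, ← natDegree_countPoly]
    exact monic_countPoly s

theorem catalan_pos (m : ℕ) : 0 < catalan m := by
  rw [← BinaryTree.treesOfNumNodesEq_card_eq_catalan, Finset.card_pos]
  exact ⟨leftComb m, by simp [numNodes_leftComb]⟩

theorem natDegree_sum_countPoly (m : ℕ) :
    (∑ s ∈ BinaryTree.treesOfNumNodesEq m, countPoly s).natDegree = 2 * m := by
  refine natDegree_eq_of_le_of_coeff_ne_zero (natDegree_sum_countPoly_le m) ?_
  rw [coeff_sum_countPoly]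
  exact_mod_cast (catalan_pos m).ne'

theorem leadingCoeff_sum_countPoly (m : ℕ) :
    (∑ s ∈ BinaryTree.treesOfNumNodesEq m, countPoly s).leadingCoeff = catalan m := by
  rw [leadingCoeff, natDegree_sum_countPoly, coeff_sum_countPoly]

theorem sum_countPoly_eq (m : ℕ) :
    ∑ s ∈ BinaryTree.treesOfNumNodesEq (m + 1), countPoly s =
      X ^ (m + 2) * ∑ s ∈ BinaryTree.treesOfNumNodesEq (m + 1),
        X ^ rightEdges s * (X - 1) ^ leftEdges s := by
  rw [Finset.mul_sum]
  refine Finset.sum_congr rfl fun s hs => ?_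
  rw [countPoly_eq (ne_nil_of_mem hs), BinaryTree.mem_treesOfNumNodesEq.1 hs]

/-- At `0` only the left comb contributes. -/
theorem eval_zero_sum (m : ℕ) :
    (∑ s ∈ BinaryTree.treesOfNumNodesEq (m + 1),
      X ^ rightEdges s * (X - 1) ^ leftEdges s : ℤ[X]).eval 0 = (-1) ^ m := by
  have hmem : leftComb (m + 1) ∈ BinaryTree.treesOfNumNodesEq (m + 1) := by
    simp [numNodes_leftComb]
  rw [eval_finsetSum, Finset.sum_eq_single_of_mem _ hmem]
  · have h := leftEdges_add_rightEdges (ne_nil_of_mem hmem)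
    rw [rightEdges_leftComb, numNodes_leftComb] at h
    obtain h : leftEdges (leftComb (m + 1)) = m := by omega
    simp [rightEdges_leftComb, h]
  · intro s hs hne
    have : rightEdges s ≠ 0 := fun h0 => hne <| by
      rw [← BinaryTree.mem_treesOfNumNodesEq.1 hs]
      exact eq_leftComb_of_rightEdges_eq_zero h0
    simp [this]

/-- Reflection exchanges left and right children, hence `X` and `X - 1`, which are opposite to each
other at `1/2`. If the number of internal edges is odd, the contributions of a tree and of its
mirror image cancel. -/
theorem aeval_half_sum_countPoly {m : ℕ} (hm : m ≠ 0) (heven : Even m) :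
    aeval (1 / 2 : ℚ) (∑ s ∈ BinaryTree.treesOfNumNodesEq m, countPoly s) = 0 := by
  obtain ⟨m, rfl⟩ := Nat.exists_eq_succ_of_ne_zero hm
  have key : ∀ s ∈ BinaryTree.treesOfNumNodesEq (m + 1),
      aeval (1 / 2 : ℚ) (countPoly s) = -aeval (1 / 2 : ℚ) (countPoly (mirror s)) := by
    intro s hs
    have hne := ne_nil_of_mem hs
    have hodd : Odd (leftEdges s + rightEdges s) := by
      rw [← Nat.not_even_iff_odd]
      intro h
      have := leftEdges_add_rightEdges hne
      rw [BinaryTree.mem_treesOfNumNodesEq.1 hs] at this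
      exact Nat.not_even_iff_odd.2 h.add_one (this ▸ heven)
    rw [countPoly_eq hne, countPoly_eq ((mirror_eq_nil_iff s).not.2 hne), numNodes_mirror,
      leftEdges_mirror, rightEdges_mirror]
    have h12 : (1 / 2 - 1 : ℚ) = -(1 / 2) := by norm_num
    simp only [map_mul, map_pow, map_sub, map_one, aeval_X, h12]
    rw [neg_pow _ (leftEdges s), neg_pow _ (rightEdges s)]
    obtain ⟨h1, h2⟩ | ⟨h1, h2⟩ : (Odd (leftEdges s) ∧ Even (rightEdges s)) ∨
        (Even (leftEdges s) ∧ Odd (rightEdges s)) := by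
      rw [Nat.odd_add] at hodd
      rcases Nat.even_or_odd (leftEdges s) with h | h
      · exact .inr ⟨h, by
          rw [← Nat.not_even_iff_odd, ← hodd, Nat.not_odd_iff_even]; exact h⟩
      · exact .inl ⟨h, hodd.1 h⟩
    · rw [h1.neg_one_pow, h2.neg_one_pow]
      ring
    · rw [h1.neg_one_pow, h2.neg_one_pow]
      ring
  have hsum : ∑ s ∈ BinaryTree.treesOfNumNodesEq (m + 1), aeval (1 / 2 : ℚ) (countPoly s) =
      ∑ s ∈ BinaryTree.treesOfNumNodesEq (m + 1), aeval (1 / 2 : ℚ) (countPoly (mirror s)) :=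
    Finset.sum_nbij' mirror mirror (by simp [numNodes_mirror]) (by simp [numNodes_mirror])
      (fun s _ => mirror_mirror s) (fun s _ => mirror_mirror s)
      (fun s _ => by rw [mirror_mirror])
  have hneg := Finset.sum_congr (rfl : BinaryTree.treesOfNumNodesEq (m + 1) = _) key
  rw [Finset.sum_neg_distrib, ← hsum] at hneg
  rw [map_sum]
  linarith

end CountingPolynomial

end TwoParamAs

theorem corollary1p4 (n : ℕ) (hn : 1 ≤ n) :
    ∃ p : Polynomial ℤ,
      (∀ (K : Type*) [Field K] (Ω : Type*) [Semigroup Ω] [Finite Ω],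
        Module.Finite K (TwoParamAs.As2 K Ω n) ∧
          (Module.finrank K (TwoParamAs.As2 K Ω n) : ℤ) = p.eval (Nat.card Ω : ℤ)) ∧
      (p.natDegree = 2 * n - 2 ∧ p.leadingCoeff = (catalan (n - 1) : ℤ)) ∧
      (2 ≤ n → ∃ q : Polynomial ℤ, p = Polynomial.X ^ n * q ∧ q.eval 0 = (-1) ^ n) ∧
      (Odd n → 3 ≤ n → Polynomial.aeval (1 / 2 : ℚ) p = 0) := by
  obtain ⟨m, rfl⟩ : ∃ m, n = m + 1 := ⟨n - 1, by omega⟩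
  refine ⟨∑ s ∈ BinaryTree.treesOfNumNodesEq m, TwoParamAs.countPoly s, ?_, ⟨?_, ?_⟩, ?_, ?_⟩
  · intro K _ Ω _ _
    have := Fintype.ofFinite Ω
    have e := TwoParamAs.as2Equiv K Ω (m + 1)
    have hfin : Finite {t : TwoParamAs.DecTree Ω (m + 1) // TwoParamAs.IsNormal t.1} :=
      Finite.of_equiv _ (TwoParamAs.normalTreesEquiv m).symm
    have := Fintype.ofFinite {t : TwoParamAs.DecTree Ω (m + 1) // TwoParamAs.IsNormal t.1}
    refine ⟨Module.Finite.equiv e.symm, ?_⟩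
    rw [e.finrank_eq, Module.finrank_finsupp_self, ← Nat.card_eq_fintype_card,
      TwoParamAs.card_isNormal]
  · rw [TwoParamAs.natDegree_sum_countPoly]
    omega
  · exact TwoParamAs.leadingCoeff_sum_countPoly m
  · intro h
    obtain ⟨k, rfl⟩ : ∃ k, m = k + 1 := ⟨m - 1, by omega⟩
    exact ⟨_, TwoParamAs.sum_countPoly_eq k, by rw [TwoParamAs.eval_zero_sum]; ring⟩
  · intro hodd h
    refine TwoParamAs.aeval_half_sum_countPoly (by omega) ?_
    simpa [Nat.odd_add_one] using hodd
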